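/- For $d\in\mathbb N$, let $\sigma$ denote the surface measure on the unit sphere $\mathbb S^{d-1}\subset\mathbb R^d$, let $|\cdot|$ be the Euclidean norm, and define the spherical multiplier $\mu=\mu_d:\mathbb R^d\to\mathbb C$ by $$\mu(\xi)=\frac{1}{\sigma(\mathbb S^{d-1})}\int_{\mathbb S^{d-1}}e^{-2\pi i\,x\cdot\xi}\,d\sigma(x),\qquad \xi\in\mathbb R^d .$$ There is a universal constant $C>0$, independent of $d$ and $\xi$, such that for every $d\ge 3$ the function $\mu$ is differentiable on $\mathbb R^d$ and, for every $\xi\in\mathbb R^d$, $$|\mu(\xi)-1|\le C\,\frac{|\xi|}{\sqrt d},\qquad |\mu(\xi)|\le C\,\frac{\sqrt d}{|\xi|}\ \ (\xi\ne 0),\qquad |\langle\xi,\nabla\mu(\xi)\rangle|\le C,$$ where $\langle\xi,\nabla\mu(\xi)\rangle=\sum_{j=1}^d\xi_j\,\partial_j\mu(\xi)$. -/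

import Mathlib

open MeasureTheory

noncomputable section

/-- The surface measure `σ` on the unit sphere `S^{d-1}` of the Euclidean space `ℝ^d`. -/
def surfaceMeasure (d : ℕ) : Measure (Metric.sphere (0 : EuclideanSpace ℝ (Fin d)) 1) :=
  (volume : Measure (EuclideanSpace ℝ (Fin d))).toSphere

/-- The spherical multiplier
`μ(ξ) = σ(S^{d-1})⁻¹ ∫_{S^{d-1}} exp(-2πi x·ξ) dσ(x)`. -/
def sphericalMultiplier (d : ℕ) (ξ : EuclideanSpace ℝ (Fin d)) : ℂ :=
  (((surfaceMeasure d).real Set.univ : ℝ) : ℂ)⁻¹ *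
    ∫ x : Metric.sphere (0 : EuclideanSpace ℝ (Fin d)) 1,
      Complex.exp (-2 * Real.pi * Complex.I *
        ((inner ℝ (x : EuclideanSpace ℝ (Fin d)) ξ : ℝ) : ℂ)) ∂(surfaceMeasure d)

/-- The gradient `∇f(ξ) = (∂₁f(ξ), …, ∂_d f(ξ))` of a complex-valued function on `ℝ^d`
(meaningful where `f` is differentiable). -/
def gradC {d : ℕ} (f : EuclideanSpace ℝ (Fin d) → ℂ) (ξ : EuclideanSpace ℝ (Fin d)) :
    Fin d → ℂ :=
  fun j => fderiv ℝ f ξ (EuclideanSpace.single j 1)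

end

/-! On the sphere the integrand depends on $x$ only through $t=\langle x,u\rangle$, $u=\xi/|\xi|$,
and $t=\cos\theta$ is distributed with density proportional to $\sin^{d-2}\theta$ on $[0,\pi]$.
Hence $\mu(\xi)$ is the average of $e^{il\cos\theta}$ with $l=-2\pi|\xi|$, and
$\langle\xi,\nabla\mu\rangle$ that of $il\cos\theta\,e^{il\cos\theta}$.

The slice formula `exists_integral_zonal_eq` comes from integrating a zonal function over the unit
ball in two ways: radius times direction, and coordinate along $u$ times orthogonal complement. Its
constant is never computed; testing on $g=1$ removes it (`average_zonal_eq`).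

The mean of $\cos^2\theta$ is $1/d$, so that of $|\cos\theta|$ is at most $1/\sqrt d$, which gives
the bound near $0$. For decay, one factor $\sin\theta$ makes $\sin\theta\,e^{il\cos\theta}$ an exact
derivative up to $-il$; integrating by parts (`abs_mul_norm_integral_mul_exp_le`) gains $1/|l|$ at
the price of boundary terms and a total variation, evaluated by the Wallis recursion. -/

/-! ### Polar coordinates and the slice formula -/

open Set in
theorem integral_norm_mul_direction {E : Type*} [NormedAddCommGroup E] [NormedSpace ℝ E]
    [MeasurableSpace E] [BorelSpace E] [FiniteDimensional ℝ E]
    (ν : Measure E) [ν.IsAddHaarMeasure] [Nontrivial E] (h : ℝ → ℂ) (G : E → ℂ) :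
    ∫ x, h ‖x‖ * G (‖x‖⁻¹ • x) ∂ν =
      (∫ x : Metric.sphere (0 : E) 1, G x ∂ν.toSphere) *
        ∫ r : Ioi (0 : ℝ), h r ∂Measure.volumeIoiPow (Module.finrank ℝ E - 1) := by
  calc
    ∫ x, h ‖x‖ * G (‖x‖⁻¹ • x) ∂ν
      = ∫ x : ({(0)}ᶜ : Set E), h ‖x.1‖ * G (‖x.1‖⁻¹ • x.1) ∂(ν.comap (↑)) := by
      rw [integral_subtype_comap (measurableSet_singleton _).compl
        fun x ↦ h ‖x‖ * G (‖x‖⁻¹ • x), restrict_compl_singleton]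
    _ = ∫ x, G x.1 * h x.2 ∂ν.toSphere.prod (.volumeIoiPow (Module.finrank ℝ E - 1)) := by
      simpa [mul_comm] using ν.measurePreserving_homeomorphUnitSphereProd.integral_comp
        (Homeomorph.measurableEmbedding _)
        (fun p : Metric.sphere (0 : E) 1 × Ioi (0 : ℝ) ↦ G p.1 * h p.2)
    _ = _ := integral_prod_mul (fun x : Metric.sphere (0 : E) 1 ↦ G x) (fun r : Ioi (0 : ℝ) ↦ h r)

/-- The first coordinate and the remaining ones, as a measure preserving equivalence. -/
def euclideanSplit (m : ℕ) :
    EuclideanSpace ℝ (Fin (m + 1)) ≃ᵐ ℝ × EuclideanSpace ℝ (Fin m) :=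
  (MeasurableEquiv.toLp 2 (Fin (m + 1) → ℝ)).symm.trans <|
    (MeasurableEquiv.piFinSuccAbove (fun _ => ℝ) 0).trans <|
      (MeasurableEquiv.refl ℝ).prodCongr (MeasurableEquiv.toLp 2 (Fin m → ℝ))

theorem measurePreserving_euclideanSplit (m : ℕ) :
    MeasurePreserving (euclideanSplit m) volume volume :=
  (((MeasurePreserving.id volume).prod (PiLp.volume_preserving_toLp (Fin m))).comp
    (volume_preserving_piFinSuccAbove (fun _ => ℝ) 0)).comp
      (PiLp.volume_preserving_ofLp (Fin (m + 1)))

theorem euclideanSplit_fst {m : ℕ} (x : EuclideanSpace ℝ (Fin (m + 1))) :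
    (euclideanSplit m x).1 = x 0 := rfl

theorem norm_euclideanSplit {m : ℕ} (x : EuclideanSpace ℝ (Fin (m + 1))) :
    √((euclideanSplit m x).1 ^ 2 + ‖(euclideanSplit m x).2‖ ^ 2) = ‖x‖ := by
  have h : ∀ i, (euclideanSplit m x).2 i = x i.succ := fun i => rfl
  rw [EuclideanSpace.norm_eq x, Fin.sum_univ_succ, EuclideanSpace.norm_sq_eq, euclideanSplit_fst]
  simp [h]

theorem exists_orthonormalBasis_zero {m : ℕ} (u : EuclideanSpace ℝ (Fin (m + 1)))
    (hu : ‖u‖ = 1) :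
    ∃ b : OrthonormalBasis (Fin (m + 1)) ℝ (EuclideanSpace ℝ (Fin (m + 1))), b 0 = u := by
  have hv : Orthonormal ℝ (Set.domRestrict ({0} : Set (Fin (m + 1))) fun _ => u) := by
    rw [orthonormal_iff_ite]
    intro i j
    have : i = j := Subsingleton.elim _ _
    simp [this, hu]
  obtain ⟨b, hb⟩ := hv.exists_orthonormalBasis_extension_of_card_eq (by simp)
  exact ⟨b, hb 0 rfl⟩

theorem exists_measurePreserving_split {m : ℕ} (u : EuclideanSpace ℝ (Fin (m + 1)))
    (hu : ‖u‖ = 1) :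
    ∃ e : EuclideanSpace ℝ (Fin (m + 1)) ≃ᵐ ℝ × EuclideanSpace ℝ (Fin m),
      MeasurePreserving e volume volume ∧ (∀ x, (e x).1 = inner ℝ x u) ∧
        ∀ x, √((e x).1 ^ 2 + ‖(e x).2‖ ^ 2) = ‖x‖ := by
  obtain ⟨b, hb⟩ := exists_orthonormalBasis_zero u hu
  refine ⟨b.measurableEquiv.trans (euclideanSplit m),
    (measurePreserving_euclideanSplit m).comp b.measurePreserving_repr, fun x => ?_, fun x => ?_⟩
  · change (b.repr x) 0 = _
    rw [b.repr_apply_apply, hb, real_inner_comm]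
  · change √((euclideanSplit m (b.repr x)).1 ^ 2 + ‖(euclideanSplit m (b.repr x)).2‖ ^ 2) = _
    rw [norm_euclideanSplit, LinearIsometryEquiv.norm_map]

open Set in
theorem integral_halfPlane_polar (n : ℕ) (h g : ℝ → ℂ) :
    ∫ p : ℝ × ℝ, (Ioi (0 : ℝ)).indicator (fun ρ => ((ρ ^ n : ℝ) : ℂ) *
        (h √(p.1 ^ 2 + ρ ^ 2) * g (p.1 / √(p.1 ^ 2 + ρ ^ 2)))) p.2 =
      (∫ r in Ioi (0 : ℝ), ((r ^ (n + 1) : ℝ) : ℂ) * h r) *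
        ∫ θ in (0 : ℝ)..Real.pi, ((Real.sin θ ^ n : ℝ) : ℂ) * g (Real.cos θ) := by
  rw [← integral_comp_polarCoord_symm, intervalIntegral.integral_of_le Real.pi_pos.le,
    integral_Ioc_eq_integral_Ioo, polarCoord_target,
    ← setIntegral_prod_mul (fun r : ℝ => ((r ^ (n + 1) : ℝ) : ℂ) * h r)
      (fun θ : ℝ => ((Real.sin θ ^ n : ℝ) : ℂ) * g (Real.cos θ)), ← Measure.volume_eq_prod]
  have hsub : Ioi (0 : ℝ) ×ˢ Ioo 0 Real.pi ⊆ Ioi (0 : ℝ) ×ˢ Ioo (-Real.pi) Real.pi :=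
    prod_mono le_rfl (Ioo_subset_Ioo_left (by linarith [Real.pi_pos]))
  -- Angles $\theta\le 0$ have $r\sin\theta\le 0$, where the half-plane indicator vanishes.
  rw [setIntegral_eq_of_subset_of_forall_sdiff_eq_zero (measurableSet_Ioi.prod measurableSet_Ioo)
    hsub]
  · refine setIntegral_congr_fun (measurableSet_Ioi.prod measurableSet_Ioo) ?_
    rintro ⟨r, θ⟩ ⟨hr, hθ⟩
    have hr' : (0 : ℝ) < r := hr
    have hs : 0 < r * Real.sin θ := mul_pos hr' (Real.sin_pos_of_mem_Ioo hθ)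
    have hsqrt : √((r * Real.cos θ) ^ 2 + (r * Real.sin θ) ^ 2) = r := by
      rw [show (r * Real.cos θ) ^ 2 + (r * Real.sin θ) ^ 2 = r ^ 2 by
        linear_combination r ^ 2 * Real.sin_sq_add_cos_sq θ, Real.sqrt_sq hr'.le]
    simp only [polarCoord_symm_apply]
    rw [indicator_of_mem (mem_Ioi.2 hs), hsqrt, mul_div_cancel_left₀ _ hr'.ne', mul_pow,
      Complex.real_smul]
    push_cast
    ring
  · rintro ⟨r, θ⟩ ⟨⟨hr, hθ⟩, hn⟩
    have hr' : (0 : ℝ) < r := hr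
    have hθ0 : θ ≤ 0 := by
      by_contra hlt
      exact hn ⟨hr, not_le.1 hlt, hθ.2⟩
    have hs : r * Real.sin θ ≤ 0 :=
      mul_nonpos_of_nonneg_of_nonpos hr'.le
        (Real.sin_nonpos_of_nonpos_of_neg_pi_le hθ0 hθ.1.le)
    simp only [polarCoord_symm_apply]
    rw [indicator_of_notMem (show r * Real.sin θ ∉ Ioi 0 from not_lt.2 hs), smul_zero]

/-- The zonal function `g (t / √(t² + ρ²))` cut off to the half-disc. -/
noncomputable def zonalCutoff (g : ℝ → ℂ) (t ρ : ℝ) : ℂ :=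
  (Set.Iio (1 : ℝ)).indicator 1 √(t ^ 2 + ρ ^ 2) * g (t / √(t ^ 2 + ρ ^ 2))

theorem measurable_zonalCutoff {α : Type*} [MeasurableSpace α] {g : ℝ → ℂ}
    (hg : Continuous g) {a b : α → ℝ} (ha : Measurable a) (hb : Measurable b) :
    Measurable fun x => zonalCutoff g (a x) (b x) := by
  unfold zonalCutoff
  have h1 : Measurable fun x => √(a x ^ 2 + b x ^ 2) := by fun_prop
  exact ((measurable_one.indicator measurableSet_Iio).comp h1).mul
    (hg.measurable.comp (ha.div h1))

theorem norm_zonalCutoff_le {g : ℝ → ℂ} {M : ℝ} (hM : ∀ t, ‖g t‖ ≤ M) (t ρ : ℝ) :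
    ‖zonalCutoff g t ρ‖ ≤ M := by
  rw [zonalCutoff, norm_mul]
  have : ‖(Set.Iio (1 : ℝ)).indicator (1 : ℝ → ℂ) √(t ^ 2 + ρ ^ 2)‖ ≤ 1 := by
    rw [Set.indicator_apply]
    split_ifs <;> simp
  calc _ ≤ 1 * M := mul_le_mul this (hM _) (norm_nonneg _) zero_le_one
    _ = M := one_mul M

theorem zonalCutoff_eq_zero {g : ℝ → ℂ} {t ρ : ℝ} (h : 1 ≤ √(t ^ 2 + ρ ^ 2)) :
    zonalCutoff g t ρ = 0 := by
  rw [zonalCutoff, Set.indicator_of_notMem (show _ ∉ Set.Iio (1 : ℝ) from not_lt.2 h), zero_mul]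

open Set in
theorem integrable_zonalCutoff_halfPlane {g : ℝ → ℂ} (hg : Continuous g) {M : ℝ}
    (hM : ∀ t, ‖g t‖ ≤ M) (n : ℕ) :
    Integrable fun p : ℝ × ℝ => (Ioi (0 : ℝ)).indicator
      (fun ρ => ((ρ ^ n : ℝ) : ℂ) * zonalCutoff g p.1 ρ) p.2 := by
  have hM0 : 0 ≤ M := (norm_nonneg _).trans (hM 0)
  have hmeas : Measurable fun p : ℝ × ℝ => (Ioi (0 : ℝ)).indicator
      (fun ρ => ((ρ ^ n : ℝ) : ℂ) * zonalCutoff g p.1 ρ) p.2 := by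
    have h0 : Measurable fun p : ℝ × ℝ => ((p.2 ^ n : ℝ) : ℂ) * zonalCutoff g p.1 p.2 :=
      (by fun_prop : Measurable fun p : ℝ × ℝ => ((p.2 ^ n : ℝ) : ℂ)).mul
        (measurable_zonalCutoff hg measurable_fst measurable_snd)
    exact h0.indicator (measurable_snd measurableSet_Ioi)
  have hfin : volume (Icc (-1 : ℝ) 1 ×ˢ Icc (0 : ℝ) 1) ≠ ⊤ :=
    (isCompact_Icc.prod isCompact_Icc).measure_lt_top.ne
  refine (integrableOn_iff_integrable_of_support_subset (s := Icc (-1 : ℝ) 1 ×ˢ Icc (0 : ℝ) 1)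
    ?_).1 (IntegrableOn.of_bound hfin.lt_top hmeas.aestronglyMeasurable M ?_)
  · rintro ⟨t, ρ⟩ hp
    by_cases hρ : 0 < ρ
    · have hlt : √(t ^ 2 + ρ ^ 2) < 1 := by
        by_contra hge
        exact hp (by simp [zonalCutoff_eq_zero (not_lt.1 hge)])
      rw [Real.sqrt_lt' one_pos] at hlt
      exact ⟨⟨by nlinarith, by nlinarith⟩, ⟨hρ.le, by nlinarith⟩⟩
    · exact absurd (indicator_of_notMem hρ _) hp
  · refine (ae_restrict_mem (measurableSet_Icc.prod measurableSet_Icc)).mono ?_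
    rintro ⟨t, ρ⟩ ⟨-, hρ0, hρ1⟩
    refine (norm_indicator_le_norm_self _ _).trans ?_
    simp only [norm_mul, Complex.norm_real, norm_pow, Real.norm_eq_abs] at hρ0 hρ1 ⊢
    rw [abs_of_nonneg hρ0]
    calc _ ≤ 1 * M := mul_le_mul (pow_le_one₀ hρ0 hρ1) (norm_zonalCutoff_le hM _ _)
          (norm_nonneg _) zero_le_one
      _ = M := one_mul M

theorem integrable_zonalCutoff_split {g : ℝ → ℂ} (hg : Continuous g) {M : ℝ}
    (hM : ∀ t, ‖g t‖ ≤ M) (m : ℕ) :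
    Integrable fun p : ℝ × EuclideanSpace ℝ (Fin m) => zonalCutoff g p.1 ‖p.2‖ := by
  have hmeas : Measurable fun p : ℝ × EuclideanSpace ℝ (Fin m) => zonalCutoff g p.1 ‖p.2‖ :=
    measurable_zonalCutoff hg measurable_fst measurable_snd.norm
  have hon : IntegrableOn (fun p : ℝ × EuclideanSpace ℝ (Fin m) => zonalCutoff g p.1 ‖p.2‖)
      (Metric.closedBall 0 1) :=
    IntegrableOn.of_bound (isCompact_closedBall _ _).measure_lt_top hmeas.aestronglyMeasurable M
      (ae_of_all _ fun p => norm_zonalCutoff_le hM _ _)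
  refine (integrableOn_iff_integrable_of_support_subset ?_).1 hon
  rintro ⟨t, y⟩ hp
  have hlt : √(t ^ 2 + ‖y‖ ^ 2) < 1 := by
    by_contra hge
    exact hp (zonalCutoff_eq_zero (not_lt.1 hge))
  rw [Real.sqrt_lt' one_pos] at hlt
  rw [mem_closedBall_zero_iff, Prod.norm_def, max_le_iff]
  exact ⟨by rw [Real.norm_eq_abs, abs_le]; constructor <;> nlinarith [sq_nonneg ‖y‖],
    by nlinarith [sq_nonneg t, norm_nonneg y]⟩

-- Polar coordinates in $\mathbb R^{n+1}$ turn $y$ into $\rho=\|y\|$ with weight $\rho^n$; planar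
-- polar coordinates in $(t,\rho)$ then separate radius from angle. The prefactor is the area of
-- $\mathbb S^n$.
open Set in
theorem integral_zonalCutoff_split {g : ℝ → ℂ} (hg : Continuous g) {M : ℝ}
    (hM : ∀ t, ‖g t‖ ≤ M) (n : ℕ) :
    ∫ p : ℝ × EuclideanSpace ℝ (Fin (n + 1)), zonalCutoff g p.1 ‖p.2‖ =
      (((n + 1 : ℕ) : ℝ) *
        volume.real (Metric.ball (0 : EuclideanSpace ℝ (Fin (n + 1))) 1) : ℝ) *
      ((∫ r in Ioi (0 : ℝ), ((r ^ (n + 1) : ℝ) : ℂ) * (Iio (1 : ℝ)).indicator 1 r) *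
        ∫ θ in (0 : ℝ)..Real.pi, ((Real.sin θ ^ n : ℝ) : ℂ) * g (Real.cos θ)) := by
  rw [← integral_halfPlane_polar]
  change _ = _ * ∫ p : ℝ × ℝ, (Ioi (0 : ℝ)).indicator
      (fun ρ => ((ρ ^ n : ℝ) : ℂ) * zonalCutoff g p.1 ρ) p.2
  have h1 := integrable_zonalCutoff_split hg hM (n + 1)
  have h2 := integrable_zonalCutoff_halfPlane hg hM n
  rw [Measure.volume_eq_prod] at h1 h2 ⊢
  rw [integral_prod _ h1, Measure.volume_eq_prod, integral_prod _ h2,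
    ← integral_const_mul]
  refine integral_congr_ae (Filter.Eventually.of_forall fun t => ?_)
  simp only
  rw [integral_fun_norm_addHaar volume (fun ρ => zonalCutoff g t ρ),
    integral_indicator measurableSet_Ioi]
  simp [mul_assoc]

theorem integral_indicator_volumeIoiPow_ne_zero (n : ℕ) :
    ∫ r : Set.Ioi (0 : ℝ), (Set.Iio (1 : ℝ)).indicator (1 : ℝ → ℂ) r
      ∂Measure.volumeIoiPow n ≠ 0 := by
  have h : (fun r : Set.Ioi (0 : ℝ) => (Set.Iio (1 : ℝ)).indicator (1 : ℝ → ℂ) r) =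
      (Set.Iio (⟨1, Set.mem_Ioi.2 one_pos⟩ : Set.Ioi (0 : ℝ))).indicator 1 := rfl
  rw [h, integral_indicator measurableSet_Iio]
  simp only [Pi.one_apply, integral_const, measureReal_restrict_apply_univ]
  rw [Measure.real, Measure.volumeIoiPow_apply_Iio, ENNReal.toReal_ofReal (by positivity)]
  simp
  norm_cast

/-- The slice formula for zonal functions on the unit sphere of `ℝ^{n+2}`. -/
theorem exists_integral_zonal_eq {n : ℕ} (u : EuclideanSpace ℝ (Fin (n + 2))) (hu : ‖u‖ = 1) :
    ∃ c : ℂ, ∀ (g : ℝ → ℂ) (M : ℝ), Continuous g → (∀ t, ‖g t‖ ≤ M) →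
      ∫ x : Metric.sphere (0 : EuclideanSpace ℝ (Fin (n + 2))) 1,
          g (inner ℝ (x : EuclideanSpace ℝ (Fin (n + 2))) u) ∂(surfaceMeasure (n + 2)) =
        c * ∫ θ in (0 : ℝ)..Real.pi, ((Real.sin θ ^ n : ℝ) : ℂ) * g (Real.cos θ) := by
  obtain ⟨e, he, hfst, hnorm⟩ := exists_measurePreserving_split u hu
  set A := ∫ r : Set.Ioi (0 : ℝ), (Set.Iio (1 : ℝ)).indicator (1 : ℝ → ℂ) r
    ∂Measure.volumeIoiPow (Module.finrank ℝ (EuclideanSpace ℝ (Fin (n + 2))) - 1) with hA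
  have hA0 : A ≠ 0 := integral_indicator_volumeIoiPow_ne_zero _
  -- Only independence of `g` matters for this constant; `A` is the radial factor of the direct
  -- polar decomposition.
  refine ⟨(((n + 1 : ℕ) : ℝ) *
    volume.real (Metric.ball (0 : EuclideanSpace ℝ (Fin (n + 1))) 1) : ℝ) *
    (∫ r in Set.Ioi (0 : ℝ), ((r ^ (n + 1) : ℝ) : ℂ) * (Set.Iio (1 : ℝ)).indicator 1 r) / A, fun g M hg hM => ?_⟩
  have h1 := integral_norm_mul_direction (volume : Measure (EuclideanSpace ℝ (Fin (n + 2))))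
    ((Set.Iio (1 : ℝ)).indicator 1) (fun x => g (inner ℝ x u))
  have h2 : ∀ x : EuclideanSpace ℝ (Fin (n + 2)),
      (Set.Iio (1 : ℝ)).indicator 1 ‖x‖ * g (inner ℝ (‖x‖⁻¹ • x) u) =
        zonalCutoff g (e x).1 ‖(e x).2‖ := by
    intro x
    rw [zonalCutoff, hnorm, hfst, real_inner_smul_left, inv_mul_eq_div]
  simp_rw [h2] at h1
  rw [he.integral_comp e.measurableEmbedding (fun p => zonalCutoff g p.1 ‖p.2‖),
    integral_zonalCutoff_split hg hM, ← hA] at h1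
  rw [surfaceMeasure, div_mul_eq_mul_div, eq_div_iff hA0, ← h1, mul_assoc]

/-! ### Moments of the weight $\sin^n\theta$ -/

/-- The normalizing constant of the zonal density `sin θ ^ n` on `[0, π]`. -/
noncomputable def sinPowIntegral (n : ℕ) : ℝ := ∫ θ in (0 : ℝ)..Real.pi, Real.sin θ ^ n

theorem sinPowIntegral_pos (n : ℕ) : 0 < sinPowIntegral n := integral_sin_pow_pos n

theorem sinPowIntegral_one : sinPowIntegral 1 = 2 := by
  simp [sinPowIntegral]
  norm_num

theorem sinPowIntegral_add_two (n : ℕ) :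
    sinPowIntegral (n + 2) = (n + 1) / (n + 2) * sinPowIntegral n := by
  simp [sinPowIntegral, integral_sin_pow]

theorem integral_cos_sq_mul_sin_pow (n : ℕ) :
    ∫ θ in (0 : ℝ)..Real.pi, Real.cos θ ^ 2 * Real.sin θ ^ n = sinPowIntegral n / (n + 2) := by
  have h : ∀ θ : ℝ, Real.cos θ ^ 2 * Real.sin θ ^ n = Real.sin θ ^ n - Real.sin θ ^ (n + 2) := by
    intro θ
    rw [Real.cos_sq']
    ring
  simp_rw [h]
  rw [intervalIntegral.integral_sub ((by fun_prop : Continuous _).intervalIntegrable _ _)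
    ((by fun_prop : Continuous _).intervalIntegrable _ _)]
  change sinPowIntegral n - sinPowIntegral (n + 2) = _
  rw [sinPowIntegral_add_two]
  field_simp
  ring

/-- Cauchy–Schwarz in the form $|c|\le \frac a2c^2+\frac1{2a}$, with $a=\sqrt{n+2}$ chosen because
the mean of $\cos^2\theta$ is $1/a^2$. -/
theorem integral_abs_cos_mul_sin_pow_le (n : ℕ) :
    ∫ θ in (0 : ℝ)..Real.pi, |Real.cos θ| * Real.sin θ ^ n ≤ sinPowIntegral n / √(n + 2) := by
  set a := √((n : ℝ) + 2) with ha
  have ha2 : a ^ 2 = n + 2 := Real.sq_sqrt (by positivity)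
  have ha0 : 0 < a := Real.sqrt_pos.2 (by positivity)
  calc ∫ θ in (0 : ℝ)..Real.pi, |Real.cos θ| * Real.sin θ ^ n
      ≤ ∫ θ in (0 : ℝ)..Real.pi,
          (a / 2 * (Real.cos θ ^ 2 * Real.sin θ ^ n) + 1 / (2 * a) * Real.sin θ ^ n) := by
        refine intervalIntegral.integral_mono_on Real.pi_pos.le
          ((by fun_prop : Continuous _).intervalIntegrable _ _)
          ((by fun_prop : Continuous _).intervalIntegrable _ _) fun θ hθ => ?_
        have hs : 0 ≤ Real.sin θ ^ n := pow_nonneg (Real.sin_nonneg_of_mem_Icc hθ) n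
        have hc : |Real.cos θ| ≤ a / 2 * Real.cos θ ^ 2 + 1 / (2 * a) := by
          rw [← sq_abs (Real.cos θ)]
          have : a / 2 * |Real.cos θ| ^ 2 + 1 / (2 * a) - |Real.cos θ| =
              (a * |Real.cos θ| - 1) ^ 2 / (2 * a) := by
            field_simp
            ring
          have h2 : 0 ≤ (a * |Real.cos θ| - 1) ^ 2 / (2 * a) := by positivity
          linarith
        calc |Real.cos θ| * Real.sin θ ^ n
            ≤ (a / 2 * Real.cos θ ^ 2 + 1 / (2 * a)) * Real.sin θ ^ n :=
              mul_le_mul_of_nonneg_right hc hs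
          _ = _ := by ring
    _ = sinPowIntegral n / a := by
        rw [intervalIntegral.integral_add ((by fun_prop : Continuous _).intervalIntegrable _ _)
          ((by fun_prop : Continuous _).intervalIntegrable _ _),
          intervalIntegral.integral_const_mul, intervalIntegral.integral_const_mul,
          integral_cos_sq_mul_sin_pow, ← ha2]
        change _ + 1 / (2 * a) * sinPowIntegral n = _
        field_simp
        ring

/-! ### One-dimensional oscillatory integrals -/

theorem norm_integral_sin_pow_mul_exp_sub_one_le (n : ℕ) (l : ℝ) :
    ‖∫ θ in (0 : ℝ)..Real.pi, ((Real.sin θ ^ n : ℝ) : ℂ) *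
        (Complex.exp (Complex.I * ((l * Real.cos θ : ℝ) : ℂ)) - 1)‖ ≤
      |l| * (sinPowIntegral n / √(n + 2)) := by
  calc _ ≤ ∫ θ in (0 : ℝ)..Real.pi, |l| * (|Real.cos θ| * Real.sin θ ^ n) := by
        refine intervalIntegral.norm_integral_le_of_norm_le Real.pi_pos.le
          (ae_of_all _ fun θ hθ => ?_) ((by fun_prop : Continuous _).intervalIntegrable _ _)
        have hs : 0 ≤ Real.sin θ ^ n :=
          pow_nonneg (Real.sin_nonneg_of_mem_Icc (Set.Ioc_subset_Icc_self hθ)) n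
        rw [norm_mul, Complex.norm_real, Real.norm_of_nonneg hs]
        calc _ ≤ Real.sin θ ^ n * ‖l * Real.cos θ‖ :=
              mul_le_mul_of_nonneg_left Real.norm_exp_I_mul_ofReal_sub_one_le hs
          _ = _ := by rw [Real.norm_eq_abs, abs_mul]; ring
    _ ≤ _ := by
        rw [intervalIntegral.integral_const_mul]
        exact mul_le_mul_of_nonneg_left (integral_abs_cos_mul_sin_pow_le n) (abs_nonneg l)

theorem hasDerivAt_exp_I_mul_cos (l θ : ℝ) :
    HasDerivAt (fun θ : ℝ => Complex.exp (Complex.I * ((l * Real.cos θ : ℝ) : ℂ)))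
      (-(l * Complex.I) * (Real.sin θ * Complex.exp (Complex.I * ((l * Real.cos θ : ℝ) : ℂ)))) θ := by
  have h := ((((Real.hasDerivAt_cos θ).const_mul l).ofReal_comp).const_mul Complex.I).cexp
  convert h using 1
  push_cast
  ring

theorem abs_mul_norm_integral_mul_exp_le (u u' : ℝ → ℝ) (hu : ∀ θ, HasDerivAt u (u' θ) θ)
    (hu' : Continuous u') (l : ℝ) :
    |l| * ‖∫ θ in (0 : ℝ)..Real.pi, ((u θ * Real.sin θ : ℝ) : ℂ) *
        Complex.exp (Complex.I * ((l * Real.cos θ : ℝ) : ℂ))‖ ≤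
      |u Real.pi| + |u 0| + ∫ θ in (0 : ℝ)..Real.pi, |u' θ| := by
  set e : ℝ → ℂ := fun θ => Complex.exp (Complex.I * ((l * Real.cos θ : ℝ) : ℂ)) with he
  have hen : ∀ θ, ‖e θ‖ = 1 := fun θ => Complex.norm_exp_I_mul_ofReal _
  have hec : Continuous e := by fun_prop
  have hibp := intervalIntegral.integral_mul_deriv_eq_deriv_mul (a := 0) (b := Real.pi)
    (fun θ _ => (hu θ).ofReal_comp) (fun θ _ => hasDerivAt_exp_I_mul_cos l θ)
    ((Complex.continuous_ofReal.comp hu').intervalIntegrable _ _)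
    ((by fun_prop : Continuous fun θ : ℝ => -(l * Complex.I) * (Real.sin θ *
      Complex.exp (Complex.I * ((l * Real.cos θ : ℝ) : ℂ)))).intervalIntegrable _ _)
  have hl : ∫ θ in (0 : ℝ)..Real.pi, (u θ : ℂ) * (-(l * Complex.I) * (Real.sin θ *
      Complex.exp (Complex.I * ((l * Real.cos θ : ℝ) : ℂ)))) =
      -(l * Complex.I) * ∫ θ in (0 : ℝ)..Real.pi, ((u θ * Real.sin θ : ℝ) : ℂ) * e θ := by
    rw [← intervalIntegral.integral_const_mul]
    congr 1
    ext θ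
    simp only [he]
    push_cast
    ring
  rw [hl] at hibp
  have hnl : ‖-((l : ℂ) * Complex.I)‖ = |l| := by simp
  rw [← hnl, ← norm_mul, hibp]
  refine (norm_sub_le _ _).trans (add_le_add ((norm_sub_le _ _).trans (add_le_add ?_ ?_)) ?_)
  · exact (by rw [norm_mul, hen Real.pi]; simp : ‖(u Real.pi : ℂ) * e Real.pi‖ = _).le
  · exact (by rw [norm_mul, hen]; simp : ‖(u 0 : ℂ) * e 0‖ = _).le
  · refine intervalIntegral.norm_integral_le_of_norm_le Real.pi_pos.le
      (ae_of_all _ fun θ _ => ?_) ((continuous_abs.comp hu').intervalIntegrable _ _)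
    exact (by rw [norm_mul, hen]; simp : ‖(u' θ : ℂ) * e θ‖ = |u' θ|).le

theorem abs_mul_norm_integral_sin_pow_mul_exp_le (n : ℕ) (l : ℝ) :
    |l| * ‖∫ θ in (0 : ℝ)..Real.pi, ((Real.sin θ ^ (n + 1) : ℝ) : ℂ) *
        Complex.exp (Complex.I * ((l * Real.cos θ : ℝ) : ℂ))‖ ≤
      √(n + 3) * sinPowIntegral (n + 1) := by
  have h := abs_mul_norm_integral_mul_exp_le (fun θ => Real.sin θ ^ n)
    (fun θ => n * Real.sin θ ^ (n - 1) * Real.cos θ) (fun θ => (Real.hasDerivAt_sin θ).pow n)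
    (by fun_prop) l
  simp only [← pow_succ] at h
  refine h.trans ?_
  rcases n with _ | k
  -- For exponent $0$ (dimension $3$) the amplitude is constant: only the boundary terms, $1+1$,
  -- remain.
  · have : (1 : ℝ) ≤ √3 := Real.one_le_sqrt.2 (by norm_num)
    simp [sinPowIntegral_one]
    linarith
  · have habs : ∫ θ in (0 : ℝ)..Real.pi,
        |((k + 1 : ℕ) : ℝ) * Real.sin θ ^ (k + 1 - 1) * Real.cos θ| =
        (k + 1) * ∫ θ in (0 : ℝ)..Real.pi, |Real.cos θ| * Real.sin θ ^ k := by
      rw [← intervalIntegral.integral_const_mul]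
      refine intervalIntegral.integral_congr fun θ hθ => ?_
      rw [Set.uIcc_of_le Real.pi_pos.le] at hθ
      have hs : 0 ≤ Real.sin θ ^ k := pow_nonneg (Real.sin_nonneg_of_mem_Icc hθ) k
      have hk : (0 : ℝ) ≤ k + 1 := by positivity
      simp only [Nat.add_sub_cancel, abs_mul, abs_of_nonneg hs, Nat.cast_add, Nat.cast_one,
        abs_of_nonneg hk]
      ring
    rw [habs]
    have hk2 : √((k : ℝ) + 2) ^ 2 = k + 2 := Real.sq_sqrt (by positivity)
    have hk0 : 0 < √((k : ℝ) + 2) := Real.sqrt_pos.2 (by positivity)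
    calc _ = (k + 1) * ∫ θ in (0 : ℝ)..Real.pi, |Real.cos θ| * Real.sin θ ^ k := by simp
      _ ≤ (k + 1) * (sinPowIntegral k / √(k + 2)) :=
          mul_le_mul_of_nonneg_left (integral_abs_cos_mul_sin_pow_le k) (by positivity)
      _ = √(k + 2) * sinPowIntegral (k + 2) := by
          rw [sinPowIntegral_add_two]
          field_simp
          rw [hk2]
      _ ≤ √((k + 1 : ℕ) + 3) * sinPowIntegral (k + 2) := by
          refine mul_le_mul_of_nonneg_right (Real.sqrt_le_sqrt ?_) (sinPowIntegral_pos _).le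
          push_cast
          linarith

/-- The amplitude $\sin^n\theta\cos\theta$ has derivative
$n\cos^2\theta\sin^{n-1}\theta-\sin^{n+1}\theta$. For $n\ge1$ both terms have the same integral by
Wallis and the boundary vanishes, so no $\sqrt n$ is lost; for $n=0$ the boundary replaces the first
term. -/
theorem abs_mul_norm_integral_sin_pow_mul_cos_mul_exp_le (n : ℕ) (l : ℝ) :
    |l| * ‖∫ θ in (0 : ℝ)..Real.pi, ((Real.sin θ ^ (n + 1) : ℝ) : ℂ) *
        (Real.cos θ * Complex.exp (Complex.I * ((l * Real.cos θ : ℝ) : ℂ)))‖ ≤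
      2 * sinPowIntegral (n + 1) := by
  have h := abs_mul_norm_integral_mul_exp_le (fun θ => Real.sin θ ^ n * Real.cos θ)
    (fun θ => n * Real.sin θ ^ (n - 1) * Real.cos θ * Real.cos θ +
      Real.sin θ ^ n * -Real.sin θ)
    (fun θ => ((Real.hasDerivAt_sin θ).pow n).mul (Real.hasDerivAt_cos θ)) (by fun_prop) l
  have hint : ∀ θ : ℝ, ((Real.sin θ ^ (n + 1) : ℝ) : ℂ) *
      (Real.cos θ * Complex.exp (Complex.I * ((l * Real.cos θ : ℝ) : ℂ))) =
      ((Real.sin θ ^ n * Real.cos θ * Real.sin θ : ℝ) : ℂ) *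
        Complex.exp (Complex.I * ((l * Real.cos θ : ℝ) : ℂ)) := by
    intro θ
    push_cast
    ring
  simp_rw [hint]
  refine h.trans ?_
  have hle : ∫ θ in (0 : ℝ)..Real.pi, |n * Real.sin θ ^ (n - 1) * Real.cos θ * Real.cos θ +
      Real.sin θ ^ n * -Real.sin θ| ≤
      ∫ θ in (0 : ℝ)..Real.pi, (n * (Real.cos θ ^ 2 * Real.sin θ ^ (n - 1)) +
        Real.sin θ ^ (n + 1)) := by
    refine intervalIntegral.integral_mono_on Real.pi_pos.le
      ((by fun_prop : Continuous _).intervalIntegrable _ _)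
      ((by fun_prop : Continuous _).intervalIntegrable _ _) fun θ hθ => ?_
    have h0 := Real.sin_nonneg_of_mem_Icc hθ
    have h1 : 0 ≤ n * (Real.cos θ ^ 2 * Real.sin θ ^ (n - 1)) := by positivity
    have h2 : 0 ≤ Real.sin θ ^ (n + 1) := by positivity
    rw [show n * Real.sin θ ^ (n - 1) * Real.cos θ * Real.cos θ + Real.sin θ ^ n * -Real.sin θ =
      n * (Real.cos θ ^ 2 * Real.sin θ ^ (n - 1)) - Real.sin θ ^ (n + 1) by ring, abs_le]
    constructor <;> linarith
  rw [intervalIntegral.integral_add ((by fun_prop : Continuous _).intervalIntegrable _ _)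
    ((by fun_prop : Continuous _).intervalIntegrable _ _), intervalIntegral.integral_const_mul,
    integral_cos_sq_mul_sin_pow] at hle
  change _ ≤ _ + sinPowIntegral (n + 1) at hle
  rcases n with _ | k
  · simp only [sinPowIntegral_one, zero_add] at hle ⊢
    simp at hle ⊢
    linarith
  · simp only [Nat.add_sub_cancel] at hle ⊢
    simp only [Real.sin_pi, Real.sin_zero, ne_eq, Nat.add_eq_zero_iff, one_ne_zero, and_false,
      not_false_eq_true, zero_pow, zero_mul, abs_zero, zero_add]
    refine hle.trans_eq ?_
    rw [sinPowIntegral_add_two]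
    push_cast
    field_simp
    ring

/-! ### Spherical averages and the derivative of the multiplier -/

instance (d : ℕ) : IsFiniteMeasure (surfaceMeasure d) :=
  inferInstanceAs (IsFiniteMeasure (volume : Measure (EuclideanSpace ℝ (Fin d))).toSphere)

theorem surfaceMeasure_real_univ_pos (d : ℕ) (hd : d ≠ 0) :
    0 < (surfaceMeasure d).real Set.univ := by
  have : Nonempty (Fin d) := ⟨⟨0, Nat.pos_of_ne_zero hd⟩⟩
  refine ENNReal.toReal_pos ?_ (measure_ne_top _ _)
  rw [Measure.measure_univ_ne_zero]
  exact Measure.toSphere_ne_zero _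

theorem average_zonal_eq {n : ℕ} (u : EuclideanSpace ℝ (Fin (n + 2))) (hu : ‖u‖ = 1)
    {g : ℝ → ℂ} (hg : Continuous g) :
    (((surfaceMeasure (n + 2)).real Set.univ : ℝ) : ℂ)⁻¹ *
      ∫ x : Metric.sphere (0 : EuclideanSpace ℝ (Fin (n + 2))) 1,
          g (inner ℝ (x : EuclideanSpace ℝ (Fin (n + 2))) u) ∂(surfaceMeasure (n + 2)) =
        (sinPowIntegral n : ℂ)⁻¹ *
          ∫ θ in (0 : ℝ)..Real.pi, ((Real.sin θ ^ n : ℝ) : ℂ) * g (Real.cos θ) := by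
  obtain ⟨c, hc⟩ := exists_integral_zonal_eq u hu
  have hS : (((surfaceMeasure (n + 2)).real Set.univ : ℝ) : ℂ) ≠ 0 :=
    Complex.ofReal_ne_zero.2 (surfaceMeasure_real_univ_pos _ (by simp)).ne'
  have hW : (sinPowIntegral n : ℂ) ≠ 0 := Complex.ofReal_ne_zero.2 (sinPowIntegral_pos n).ne'
  have h1 : (((surfaceMeasure (n + 2)).real Set.univ : ℝ) : ℂ) = c * sinPowIntegral n := by
    have := hc (fun _ => 1) 1 continuous_const (by simp)
    simp only [mul_one, intervalIntegral.integral_ofReal] at this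
    simpa [sinPowIntegral] using this
  have hc0 : c ≠ 0 := fun h => hS (by rw [h1, h, zero_mul])
  have hle : (-1 : ℝ) ≤ 1 := by norm_num
  -- Clamping to $[-1,1]$ makes `g` bounded on the line without changing it at inner products of
  -- unit vectors or at cosines.
  set k : ℝ → ℂ := fun t => g (Set.projIcc (-1) 1 hle t) with hk
  have hkg : ∀ t ∈ Set.Icc (-1 : ℝ) 1, k t = g t := fun t ht => by
    simp only [hk, Set.projIcc_of_mem hle ht]
  obtain ⟨M, hM⟩ := isCompact_Icc.exists_bound_of_continuousOn (s := Set.Icc (-1 : ℝ) 1)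
    hg.continuousOn
  have h2 := hc k M (by fun_prop) (fun t => hM _ (Set.projIcc (-1) 1 hle t).2)
  have h3 : ∀ x : Metric.sphere (0 : EuclideanSpace ℝ (Fin (n + 2))) 1,
      k (inner ℝ (x : EuclideanSpace ℝ (Fin (n + 2))) u) =
        g (inner ℝ (x : EuclideanSpace ℝ (Fin (n + 2))) u) := fun x => by
    refine hkg _ (abs_le.1 ((abs_real_inner_le_norm _ _).trans ?_))
    simp [hu]
  have h4 : ∀ θ, k (Real.cos θ) = g (Real.cos θ) := fun θ =>
    hkg _ ⟨Real.neg_one_le_cos θ, Real.cos_le_one θ⟩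
  simp_rw [h3, h4] at h2
  rw [h2, h1]
  field_simp

theorem hasFDerivAt_sphericalMultiplier_integrand {d : ℕ} (x ξ : EuclideanSpace ℝ (Fin d)) :
    HasFDerivAt (fun ξ : EuclideanSpace ℝ (Fin d) =>
        Complex.exp (-2 * Real.pi * Complex.I * ((inner ℝ x ξ : ℝ) : ℂ)))
      ((innerSL ℝ x).smulRight (-2 * Real.pi * Complex.I *
        Complex.exp (-2 * Real.pi * Complex.I * ((inner ℝ x ξ : ℝ) : ℂ)))) ξ := by
  have h1 : HasFDerivAt (fun ξ : EuclideanSpace ℝ (Fin d) => inner ℝ x ξ) (innerSL ℝ x) ξ :=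
    (innerSL ℝ x).hasFDerivAt
  have h2 : HasDerivAt (fun t : ℝ => Complex.exp (-2 * Real.pi * Complex.I * (t : ℂ)))
      (-2 * Real.pi * Complex.I *
        Complex.exp (-2 * Real.pi * Complex.I * ((inner ℝ x ξ : ℝ) : ℂ))) (inner ℝ x ξ) := by
    have := ((Complex.ofRealCLM.hasDerivAt (x := (inner ℝ x ξ : ℝ))).const_mul
      (-2 * Real.pi * Complex.I)).cexp
    simp only [Complex.ofRealCLM_apply, Complex.ofReal_one, mul_one] at this
    exact this.congr_deriv (mul_comm _ _)
  exact h2.hasFDerivAt.comp ξ h1 |>.congr_fderiv (by ext; simp)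

theorem norm_exp_neg_two_pi_I_mul (t : ℝ) :
    ‖Complex.exp (-2 * Real.pi * Complex.I * (t : ℂ))‖ = 1 := by
  rw [show -2 * Real.pi * Complex.I * (t : ℂ) = Complex.I * ((-2 * Real.pi * t : ℝ) : ℂ) by
    push_cast; ring]
  exact Complex.norm_exp_I_mul_ofReal _

/-- Differentiation under the integral: on the unit sphere the integrand's derivative has norm at
most $2\pi$, uniformly in $\xi$. -/
theorem hasFDerivAt_sphericalMultiplier {d : ℕ} (ξ : EuclideanSpace ℝ (Fin d)) :
    ∃ L : EuclideanSpace ℝ (Fin d) →L[ℝ] ℂ, HasFDerivAt (sphericalMultiplier d) L ξ ∧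
      ∀ v, L v = (((surfaceMeasure d).real Set.univ : ℝ) : ℂ)⁻¹ *
        ∫ x : Metric.sphere (0 : EuclideanSpace ℝ (Fin d)) 1,
          (inner ℝ (x : EuclideanSpace ℝ (Fin d)) v : ℝ) * (-2 * Real.pi * Complex.I *
            Complex.exp (-2 * Real.pi * Complex.I *
              ((inner ℝ (x : EuclideanSpace ℝ (Fin d)) ξ : ℝ) : ℂ))) ∂(surfaceMeasure d) := by
  set F' : EuclideanSpace ℝ (Fin d) → Metric.sphere (0 : EuclideanSpace ℝ (Fin d)) 1 →
      EuclideanSpace ℝ (Fin d) →L[ℝ] ℂ := fun ξ x =>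
    (innerSL ℝ (x : EuclideanSpace ℝ (Fin d))).smulRight (-2 * Real.pi * Complex.I *
      Complex.exp (-2 * Real.pi * Complex.I *
        ((inner ℝ (x : EuclideanSpace ℝ (Fin d)) ξ : ℝ) : ℂ))) with hF'
  have hF'c : Continuous (F' ξ) := by
    simp only [hF']
    fun_prop
  have hbound : ∀ ξ x, ‖F' ξ x‖ ≤ 2 * Real.pi := fun ξ x => by
    simp only [hF', ContinuousLinearMap.norm_smulRight_apply, innerSL_apply_norm,
      norm_eq_of_mem_sphere, one_mul, norm_mul, norm_exp_neg_two_pi_I_mul]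
    simp [abs_of_pos Real.pi_pos]
  have hF'int : Integrable (F' ξ) (surfaceMeasure d) :=
    Integrable.of_bound hF'c.aestronglyMeasurable (2 * Real.pi) (ae_of_all _ (hbound ξ))
  have hFc : ∀ ξ : EuclideanSpace ℝ (Fin d), AEStronglyMeasurable
      (fun x : Metric.sphere (0 : EuclideanSpace ℝ (Fin d)) 1 =>
        Complex.exp (-2 * Real.pi * Complex.I *
          ((inner ℝ (x : EuclideanSpace ℝ (Fin d)) ξ : ℝ) : ℂ))) (surfaceMeasure d) := fun ξ =>
    (by fun_prop : Continuous _).aestronglyMeasurable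
  have h := hasFDerivAt_integral_of_dominated_of_fderiv_le (𝕜 := ℝ) (μ := surfaceMeasure d)
    (x₀ := ξ) (F' := F') (bound := fun _ => 2 * Real.pi) Filter.univ_mem
    (Filter.Eventually.of_forall hFc)
    (Integrable.of_bound (hFc ξ) 1 (ae_of_all _ fun x => (norm_exp_neg_two_pi_I_mul _).le))
    hF'c.aestronglyMeasurable (ae_of_all _ fun x ξ _ => hbound ξ x) (integrable_const _)
    (ae_of_all _ fun x ξ _ => hasFDerivAt_sphericalMultiplier_integrand _ ξ)
  refine ⟨_, h.const_mul _, fun v => ?_⟩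
  rw [smul_apply, ContinuousLinearMap.integral_apply hF'int, smul_eq_mul]
  simp [hF']

theorem sum_mul_gradC {d : ℕ} (f : EuclideanSpace ℝ (Fin d) → ℂ) (ξ : EuclideanSpace ℝ (Fin d)) :
    ∑ j, (ξ j : ℂ) * gradC f ξ j = fderiv ℝ f ξ ξ := by
  have h : ξ = ∑ j, ξ j • EuclideanSpace.single j (1 : ℝ) := by
    ext i
    simp [Finset.sum_apply, Pi.single_apply]
  conv_rhs => rw [h, map_sum]
  simp only [gradC, map_smul, Complex.real_smul]
  rw [← h]

theorem exists_unit_smul {d : ℕ} (ξ : EuclideanSpace ℝ (Fin (d + 1))) :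
    ∃ u : EuclideanSpace ℝ (Fin (d + 1)), ‖u‖ = 1 ∧ ξ = ‖ξ‖ • u := by
  by_cases h : ξ = 0
  · exact ⟨EuclideanSpace.single 0 1, by simp, by simp [h]⟩
  · exact ⟨‖ξ‖⁻¹ • ξ, norm_smul_inv_norm h, by
      rw [smul_smul, mul_inv_cancel₀ (norm_ne_zero_iff.2 h), one_smul]⟩

/-! ### Assembling the three bounds -/

theorem proposition4p3 :
    ∃ C : ℝ, 0 < C ∧ ∀ d : ℕ, 3 ≤ d →
      Differentiable ℝ (sphericalMultiplier d) ∧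
      ∀ ξ : EuclideanSpace ℝ (Fin d),
        ‖sphericalMultiplier d ξ - 1‖ ≤ C * (‖ξ‖ / Real.sqrt d) ∧
        (ξ ≠ 0 → ‖sphericalMultiplier d ξ‖ ≤ C * (Real.sqrt d / ‖ξ‖)) ∧
        ‖∑ j, (ξ j : ℂ) * gradC (sphericalMultiplier d) ξ j‖ ≤ C := by
  -- The first bound needs $|l|/|\xi|=2\pi$; the others hold with $1/(2\pi)$ and $2$.
  refine ⟨2 * Real.pi, by positivity, fun d hd => ⟨fun ξ => ?_, fun ξ => ?_⟩⟩
  · obtain ⟨L, hL, -⟩ := hasFDerivAt_sphericalMultiplier ξ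
    exact hL.differentiableAt
  -- With $d=n+3$ the density is $\sin^{n+1}\theta$, leaving a factor $\sin\theta$ for the
  -- integration by parts.
  obtain ⟨n, rfl⟩ := Nat.exists_eq_add_of_le' hd
  obtain ⟨u, hu, hξ⟩ := exists_unit_smul ξ
  obtain ⟨L, hL, hLv⟩ := hasFDerivAt_sphericalMultiplier ξ
  set r := ‖ξ‖ with hr
  have hr0 : 0 ≤ r := norm_nonneg ξ
  set l : ℝ := -2 * Real.pi * r with hl
  have hlabs : |l| = 2 * Real.pi * r := by
    rw [hl, abs_mul, abs_mul, abs_of_pos Real.pi_pos, abs_of_nonneg hr0]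
    norm_num
  have hW := sinPowIntegral_pos (n + 1)
  have hWn : ‖(sinPowIntegral (n + 1) : ℂ)⁻¹‖ = (sinPowIntegral (n + 1))⁻¹ := by
    rw [norm_inv, Complex.norm_real, Real.norm_of_nonneg hW.le]
  have hexp : ∀ x : EuclideanSpace ℝ (Fin (n + 3)),
      -2 * Real.pi * Complex.I * ((inner ℝ x ξ : ℝ) : ℂ) =
        Complex.I * ((l * inner ℝ x u : ℝ) : ℂ) := by
    intro x
    rw [hξ, real_inner_smul_right, hl]
    push_cast
    ring
  have hμ : sphericalMultiplier (n + 3) ξ = (sinPowIntegral (n + 1) : ℂ)⁻¹ *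
      ∫ θ in (0 : ℝ)..Real.pi, ((Real.sin θ ^ (n + 1) : ℝ) : ℂ) *
        Complex.exp (Complex.I * ((l * Real.cos θ : ℝ) : ℂ)) := by
    rw [sphericalMultiplier]
    simp_rw [hexp]
    exact average_zonal_eq u hu
      (g := fun t => Complex.exp (Complex.I * ((l * t : ℝ) : ℂ))) (by fun_prop)
  have hsqrt : √((n + 3 : ℕ) : ℝ) = √((n : ℝ) + 3) := by push_cast; rfl
  refine ⟨?_, fun hne => ?_, ?_⟩
  · have h1 : sphericalMultiplier (n + 3) ξ - 1 = (sinPowIntegral (n + 1) : ℂ)⁻¹ *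
        ∫ θ in (0 : ℝ)..Real.pi, ((Real.sin θ ^ (n + 1) : ℝ) : ℂ) *
          (Complex.exp (Complex.I * ((l * Real.cos θ : ℝ) : ℂ)) - 1) := by
      simp_rw [mul_sub, mul_one]
      rw [intervalIntegral.integral_sub ((by fun_prop : Continuous _).intervalIntegrable _ _)
        ((by fun_prop : Continuous _).intervalIntegrable _ _), mul_sub, ← hμ,
        intervalIntegral.integral_ofReal]
      change _ = _ - _ * (sinPowIntegral (n + 1) : ℂ)
      rw [inv_mul_cancel₀ (Complex.ofReal_ne_zero.2 hW.ne')]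
    have h2 := norm_integral_sin_pow_mul_exp_sub_one_le (n + 1) l
    rw [h1, norm_mul, hWn, inv_mul_le_iff₀ hW, hsqrt]
    refine h2.trans_eq ?_
    rw [hlabs, show (((n + 1 : ℕ) : ℝ) + 2) = n + 3 by push_cast; ring]
    ring
  · have hr1 : 0 < r := norm_pos_iff.2 hne
    have h2 := abs_mul_norm_integral_sin_pow_mul_exp_le n l
    rw [hμ, norm_mul, hWn, inv_mul_le_iff₀ hW, hsqrt]
    rw [hlabs, ← le_div_iff₀' (by positivity)] at h2
    refine h2.trans ?_
    have hpi : (1 : ℝ) ≤ 2 * Real.pi := by linarith [Real.pi_gt_three]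
    have hpos : 0 ≤ √((n : ℝ) + 3) * sinPowIntegral (n + 1) / r := by positivity
    calc √((n : ℝ) + 3) * sinPowIntegral (n + 1) / (2 * Real.pi * r)
        = √((n : ℝ) + 3) * sinPowIntegral (n + 1) / r / (2 * Real.pi) := by
          field_simp
      _ ≤ √((n : ℝ) + 3) * sinPowIntegral (n + 1) / r := div_le_self hpos hpi
      _ ≤ 2 * Real.pi * (√((n : ℝ) + 3) * sinPowIntegral (n + 1) / r) :=
          le_mul_of_one_le_left hpos hpi
      _ = _ := by ring
  -- The radial derivative carries a factor $l$, exactly cancelled by the $1/|l|$ decay of the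
  -- amplitude with $\cos\theta$.
  · rw [sum_mul_gradC, hL.fderiv, hLv]
    have hint : ∀ x : EuclideanSpace ℝ (Fin (n + 3)),
        ((inner ℝ x ξ : ℝ) : ℂ) * (-2 * Real.pi * Complex.I *
          Complex.exp (-2 * Real.pi * Complex.I * ((inner ℝ x ξ : ℝ) : ℂ))) =
        (l * Complex.I) * (((inner ℝ x u : ℝ) : ℂ) *
          Complex.exp (Complex.I * ((l * inner ℝ x u : ℝ) : ℂ))) := by
      intro x
      rw [hexp, hξ, real_inner_smul_right, hl]
      push_cast
      ring
    simp_rw [hint]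
    rw [integral_const_mul, mul_left_comm,
      average_zonal_eq u hu
        (g := fun t => (t : ℂ) * Complex.exp (Complex.I * ((l * t : ℝ) : ℂ))) (by fun_prop),
      mul_left_comm, norm_mul, hWn, inv_mul_le_iff₀ hW, norm_mul]
    have h2 := abs_mul_norm_integral_sin_pow_mul_cos_mul_exp_le n l
    have hli : ‖(l : ℂ) * Complex.I‖ = |l| := by simp
    rw [hli]
    refine h2.trans ?_
    rw [mul_comm]
    exact mul_le_mul_of_nonneg_left (by linarith [Real.pi_gt_three]) hW.le
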